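/- Let $A$ be a finite-dimensional quantum system with Hilbert space $\mathcal H_A\neq 0$, and let $\mathcal{Q}(A\otimes A)$ be the set of density matrices (positive semidefinite operators of trace one) on $\mathcal H_A\otimes\mathcal H_A$. Let $\mathcal{Q}(A\to A)$ be the set of all completely positive trace-preserving (CPTP) linear maps on the operators on $\mathcal H_A$. Let $\mathcal N$ be a linear map on the operators on $\mathcal H_A$ that is Hermitian-preserving and satisfies $\mathrm{Tr}\,\mathcal N(X)=c\,\mathrm{Tr}\,X$ for all operators $X$, with some real constant $c$ (the case $c=1$ being that of trace-preserving maps). Let $$\Vert\mathcal N\Vert_\diamond=\max_{\rho\in\mathcal Q(A\otimes A)}\frac{\Vert(\mathrm{id}\otimes\mathcal N)(\rho)\Vert_1}{\Vert\rho\Vert_1}$$ denote its diamond norm, where $\Vert X\Vert_1$ is the trace norm (the sum of the singular values of $X$), and let $$p_{\mathcal Q(A\to A)}(\mathcal N)=\inf\Big\{\sum_i|x_i| : \mathcal N=\sum_i x_i\mathcal E_i \text{ a finite sum},\ x_i\in\mathbb R,\ \mathcal E_i\in\mathcal Q(A\to A)\Big\}$$ denote its implementability with respect to the CPTP maps. Then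 the maximum is attained, such decompositions of $\mathcal N$ exist, and $$\Vert\mathcal N\Vert_\diamond=p_{\mathcal Q(A\to A)}(\mathcal N).$$ -/

import Mathlib

open scoped Kronecker ComplexOrder

noncomputable section

namespace QuantumImpl

/-- Linear operations on the operators of a system `A` whose Hilbert space is `ℂⁿ`
(the index type `n` labels an orthonormal basis). -/
abbrev Operation (n : Type*) := Matrix n n ℂ →ₗ[ℂ] Matrix n n ℂ

/-- The set `𝒬(A)` of density matrices: positive semidefinite (in particular Hermitian)
matrices of trace one. -/
def densityMatrices (m : Type*) [Fintype m] : Set (Matrix m m ℂ) :=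
  {ρ | ρ.PosSemidef ∧ ρ.trace = 1}

/-- The extended operation `id ⊗ N`, with an ancilla of basis `k`. An operator on the composite
system is a `k × k` block matrix with blocks on the system, and `N` is applied to every block. -/
def idTensor (k : Type*) {n : Type*} (N : Operation n) :
    Matrix (k × n) (k × n) ℂ →ₗ[ℂ] Matrix (k × n) (k × n) ℂ where
  toFun X := Matrix.of fun p q => N (Matrix.of fun a b => X (p.1, a) (q.1, b)) p.2 q.2
  map_add' X Y := by
    ext p q
    have h : (Matrix.of fun a b => (X + Y) (p.1, a) (q.1, b) : Matrix n n ℂ)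
        = (Matrix.of fun a b => X (p.1, a) (q.1, b))
          + (Matrix.of fun a b => Y (p.1, a) (q.1, b)) := rfl
    simp only [Matrix.of_apply, Matrix.add_apply] at h ⊢
    rw [h, map_add, Matrix.add_apply]
  map_smul' c X := by
    ext p q
    have h : (Matrix.of fun a b => (c • X) (p.1, a) (q.1, b) : Matrix n n ℂ)
        = c • (Matrix.of fun a b => X (p.1, a) (q.1, b)) := rfl
    simp only [Matrix.of_apply, Matrix.smul_apply, RingHom.id_apply] at h ⊢
    rw [h, map_smul, Matrix.smul_apply]

/-- `id ⊗ N` acts on product operators as it should. -/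
theorem idTensor_kronecker (k : Type*) {n : Type*} (N : Operation n)
    (X : Matrix k k ℂ) (Y : Matrix n n ℂ) : idTensor k N (X ⊗ₖ Y) = X ⊗ₖ N Y := by
  ext p q
  have h : (Matrix.of fun a b => (X ⊗ₖ Y) (p.1, a) (q.1, b) : Matrix n n ℂ)
      = X p.1 q.1 • Y := rfl
  change N (Matrix.of fun a b => (X ⊗ₖ Y) (p.1, a) (q.1, b)) p.2 q.2 = _
  rw [h, map_smul]
  rfl

/-- Hermitian-preserving (HP) operations. -/
def IsHermitianPreserving {n : Type*} (N : Operation n) : Prop :=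
  ∀ X : Matrix n n ℂ, X.IsHermitian → (N X).IsHermitian

/-- Trace-preserving (TP) operations. -/
def IsTracePreserving {n : Type*} [Fintype n] (N : Operation n) : Prop :=
  ∀ X : Matrix n n ℂ, (N X).trace = X.trace

/-- Operations that multiply every trace by one fixed real number `c`; the value `c = 1` gives
the trace-preserving operations. -/
def IsTraceScaling {n : Type*} [Fintype n] (N : Operation n) : Prop :=
  ∃ c : ℝ, ∀ X : Matrix n n ℂ, (N X).trace = (c : ℂ) * X.trace

/-- Completely positive (CP) operations: `id ⊗ N` is positive for every finite ancilla. -/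
def IsCompletelyPositive {n : Type*} (N : Operation n) : Prop :=
  ∀ (k : ℕ) (X : Matrix (Fin k × n) (Fin k × n) ℂ),
    X.PosSemidef → (idTensor (Fin k) N X).PosSemidef

/-- The set `𝒬(A → A)` of all CPTP channels. -/
def channels (n : Type*) [Fintype n] : Set (Operation n) :=
  {E | IsCompletelyPositive E ∧ IsTracePreserving E}

/-- The costs `∑ i, |x i|` of all quasiprobability decompositions `N = ∑ i, x i • E i` of `N`
into finitely many elements of the free set `F`. -/
def decompositionCosts {V : Type*} [AddCommGroup V] [Module ℝ V] (F : Set V) (N : V) : Set ℝ :=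
  {s | ∃ (k : ℕ) (x : Fin k → ℝ) (E : Fin k → V),
    (∀ i, E i ∈ F) ∧ N = ∑ i, x i • E i ∧ s = ∑ i, |x i|}

/-- The implementability function `p_F(N)` with respect to the free set `F`. -/
def implementability {V : Type*} [AddCommGroup V] [Module ℝ V] (F : Set V) (N : V) : ℝ :=
  sInf (decompositionCosts F N)

/-- The trace norm `‖X‖₁`: the sum of the singular values of `X`, i.e. of the square roots of the
eigenvalues of `Xᴴ X`, with multiplicity. -/
def traceNorm {m : Type*} [Fintype m] [DecidableEq m] (X : Matrix m m ℂ) : ℝ :=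
  ∑ i, √((Matrix.isHermitian_conjTranspose_mul_self X).eigenvalues i)

/-- The quotients `‖(id ⊗ N)(ρ)‖₁ / ‖ρ‖₁`, for `ρ` in the set of density matrices of `A ⊗ A`. -/
def diamondRatios {n : Type*} [Fintype n] [DecidableEq n] (N : Operation n) : Set ℝ :=
  {r | ∃ ρ ∈ densityMatrices (n × n), r = traceNorm (idTensor n N ρ) / traceNorm ρ}

/-- The diamond norm `‖N‖_⋄`. -/
def diamondNorm {n : Type*} [Fintype n] [DecidableEq n] (N : Operation n) : ℝ :=
  sSup (diamondRatios N)

end QuantumImpl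

end

/-! Write D for the diamond norm and J for the Choi matrix of N. That D bounds every cost is the
triangle inequality: channels send density matrices to density matrices, of trace norm 1.

Conversely, it suffices to find P ≥ 0 with P ≥ J and partial trace at most α·1, where α = (D + c)/2
+ ε. Padding P until its partial trace equals α·1 makes P and P - J the Choi matrices of α and α - c
times channels, so N is their difference, at cost 2α - c = D + 2ε.

For one invertible input state σ such a bound comes from a purification: the image under id ⊗ N is a
congruence transform of J, and the positive part of its Jordan decomposition, pulled back, is a
majorant whose value at σ is at most (D + c)/2 (`exists_mem_majorants_trace_le_of_posDef`). Sion's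
minimax theorem exchanges "for every σ some P" for "one P for all σ"
(`exists_mem_majorants_forall_trace_lt`), which is the operator bound on the partial trace. -/

namespace QuantumImpl

/-! ### Trace norm of Hermitian matrices -/

section TraceNorm

variable {m : Type*} [Fintype m] [DecidableEq m]

/-- The trace norm of a Hermitian matrix is the sum of the moduli of its eigenvalues. -/
theorem traceNorm_eq_sum_abs_eigenvalues {X : Matrix m m ℂ} (hX : X.IsHermitian) :
    traceNorm X = ∑ i, |hX.eigenvalues i| := by
  have hsq : X.conjTranspose * X =
      Unitary.conjStarAlgAut ℂ _ hX.eigenvectorUnitary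
        (Matrix.diagonal fun i => ((hX.eigenvalues i ^ 2 : ℝ) : ℂ)) := by
    rw [hX.eq]
    conv_lhs => rw [hX.spectral_theorem]
    rw [← map_mul, Matrix.diagonal_mul_diagonal]
    congr 2
    ext i
    simp [sq]
  -- Comparing multisets of roots avoids matching the two orderings of eigenvalues.
  have hchar : (X.conjTranspose * X).charpoly =
      ∏ i, (Polynomial.X - Polynomial.C ((hX.eigenvalues i ^ 2 : ℝ) : ℂ)) := by
    rw [hsq, Unitary.conjStarAlgAut_apply, Matrix.charpoly_mul_comm, ← mul_assoc]
    simp [Matrix.charpoly_diagonal]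
  have hroots := (Matrix.isHermitian_conjTranspose_mul_self X).roots_charpoly_eq_eigenvalues
  rw [hchar, Polynomial.roots_prod _ _ (Finset.prod_ne_zero_iff.mpr fun i _ =>
    Polynomial.X_sub_C_ne_zero _)] at hroots
  simp only [Polynomial.roots_X_sub_C, Multiset.bind_singleton] at hroots
  have h := congrArg (fun s => (s.map fun z : ℂ => √z.re).sum) hroots
  simp only [Multiset.map_map, Function.comp_def, Complex.ofReal_re, Real.sqrt_sq_eq_abs,
    RCLike.ofReal_eq_complex_ofReal] at h
  exact h.symm

/-- Jordan decomposition: a Hermitian matrix is a difference of positive semidefinite matrices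
whose traces add up to its trace norm. -/
theorem exists_posSemidef_sub_traceNorm {X : Matrix m m ℂ} (hX : X.IsHermitian) :
    ∃ P Q : Matrix m m ℂ, P.PosSemidef ∧ Q.PosSemidef ∧ X = P - Q ∧
      traceNorm X = P.trace.re + Q.trace.re := by
  set U : Matrix m m ℂ := hX.eigenvectorUnitary.1 with hU
  have hUU : U.conjTranspose * U = 1 := Unitary.coe_star_mul_self hX.eigenvectorUnitary
  have key (f : m → ℝ) (hf : ∀ i, 0 ≤ f i) :
      (U * Matrix.diagonal (fun i => (f i : ℂ)) * U.conjTranspose).PosSemidef ∧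
      (U * Matrix.diagonal (fun i => (f i : ℂ)) * U.conjTranspose).trace.re = ∑ i, f i := by
    constructor
    · apply Matrix.PosSemidef.mul_mul_conjTranspose_same
      exact Matrix.PosSemidef.diagonal fun i => by simpa using hf i
    · rw [Matrix.trace_mul_comm, ← mul_assoc, hUU, one_mul, Matrix.trace_diagonal]
      simp
  obtain ⟨hP, hPt⟩ := key (fun i => (hX.eigenvalues i)⁺) fun i => posPart_nonneg _
  obtain ⟨hQ, hQt⟩ := key (fun i => (hX.eigenvalues i)⁻) fun i => negPart_nonneg _
  refine ⟨_, _, hP, hQ, ?_, ?_⟩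
  · rw [← sub_mul, ← mul_sub, Matrix.diagonal_sub]
    conv_lhs => rw [hX.spectral_theorem, Unitary.conjStarAlgAut_apply]
    congr 3
    ext i
    rw [← Complex.ofReal_sub, posPart_sub_negPart]
    rfl
  · rw [traceNorm_eq_sum_abs_eigenvalues hX, hPt, hQt, ← Finset.sum_add_distrib]
    exact Finset.sum_congr rfl fun i _ => (posPart_add_negPart _).symm

/-- The trace norm is bounded by the traces of any decomposition into a difference of positive
semidefinite matrices. -/
theorem traceNorm_sub_le {P Q : Matrix m m ℂ} (hP : P.PosSemidef) (hQ : Q.PosSemidef) :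
    traceNorm (P - Q) ≤ P.trace.re + Q.trace.re := by
  have hX : (P - Q).IsHermitian := hP.1.sub hQ.1
  rw [traceNorm_eq_sum_abs_eigenvalues hX]
  set U : Matrix m m ℂ := hX.eigenvectorUnitary.1 with hU
  have hUU : U * U.conjTranspose = 1 := Unitary.coe_mul_star_self hX.eigenvectorUnitary
  have hUU' : U.conjTranspose * U = 1 := Unitary.coe_star_mul_self hX.eigenvectorUnitary
  -- In an eigenbasis of P - Q each eigenvalue is a difference of nonnegative diagonal entries of P
  -- and Q, so its modulus is at most their sum.
  have hD : U.conjTranspose * P * U - U.conjTranspose * Q * U =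
      Matrix.diagonal fun i => (hX.eigenvalues i : ℂ) := by
    rw [← sub_mul, ← mul_sub]
    conv_lhs => rw [hX.spectral_theorem, Unitary.conjStarAlgAut_apply]
    change U.conjTranspose * (U * _ * U.conjTranspose) * U = _
    rw [mul_assoc, mul_assoc, mul_assoc, hUU', ← mul_assoc, hUU', one_mul, mul_one]
    rfl
  have htr (R : Matrix m m ℂ) : (U.conjTranspose * R * U).trace = R.trace := by
    rw [Matrix.trace_mul_comm, ← mul_assoc, hUU, one_mul]
  have hP' := hP.conjTranspose_mul_mul_same U
  have hQ' := hQ.conjTranspose_mul_mul_same U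
  rw [← htr P, ← htr Q, Matrix.trace, Matrix.trace, Complex.re_sum, Complex.re_sum,
    ← Finset.sum_add_distrib]
  refine Finset.sum_le_sum fun i _ => ?_
  have h := congrArg Complex.re (congrFun (congrFun hD i) i)
  rw [Matrix.diagonal_apply_eq, Complex.ofReal_re, Matrix.sub_apply, Complex.sub_re] at h
  rw [← h]
  have h1 : 0 ≤ ((U.conjTranspose * P * U) i i).re := (Complex.le_def.mp hP'.diag_nonneg).1
  have h2 : 0 ≤ ((U.conjTranspose * Q * U) i i).re := (Complex.le_def.mp hQ'.diag_nonneg).1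
  simp only [Matrix.diag_apply]
  exact abs_sub_le_iff.mpr ⟨by linarith, by linarith⟩

theorem abs_trace_re_le_traceNorm {X : Matrix m m ℂ} (hX : X.IsHermitian) :
    |X.trace.re| ≤ traceNorm X := by
  obtain ⟨P, Q, hP, hQ, h, ht⟩ := exists_posSemidef_sub_traceNorm hX
  have h1 : 0 ≤ P.trace.re := (Complex.le_def.mp hP.trace_nonneg).1
  have h2 : 0 ≤ Q.trace.re := (Complex.le_def.mp hQ.trace_nonneg).1
  rw [ht, h, Matrix.trace_sub, Complex.sub_re]
  exact abs_sub_le_iff.mpr ⟨by linarith, by linarith⟩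

theorem traceNorm_of_posSemidef {P : Matrix m m ℂ} (hP : P.PosSemidef) :
    traceNorm P = P.trace.re := by
  apply le_antisymm
  · simpa using traceNorm_sub_le hP Matrix.PosSemidef.zero
  · exact (le_abs_self _).trans (abs_trace_re_le_traceNorm hP.1)

theorem traceNorm_add_le {X Y : Matrix m m ℂ} (hX : X.IsHermitian) (hY : Y.IsHermitian) :
    traceNorm (X + Y) ≤ traceNorm X + traceNorm Y := by
  obtain ⟨P, Q, hP, hQ, h, ht⟩ := exists_posSemidef_sub_traceNorm hX
  obtain ⟨P', Q', hP', hQ', h', ht'⟩ := exists_posSemidef_sub_traceNorm hY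
  have e : X + Y = (P + P') - (Q + Q') := by rw [h, h']; abel
  rw [e, ht, ht']
  refine (traceNorm_sub_le (hP.add hP') (hQ.add hQ')).trans_eq ?_
  simp only [Matrix.trace_add, Complex.add_re]
  ring

/-- Cauchy–Schwarz on the singular values. The right side is visibly continuous in X, which yields
continuity of the trace norm. -/
theorem traceNorm_le_sqrt (X : Matrix m m ℂ) :
    traceNorm X ≤ √(Fintype.card m * (X.conjTranspose * X).trace.re) := by
  have hH := Matrix.isHermitian_conjTranspose_mul_self X
  refine Real.le_sqrt_of_sq_le ?_
  have h := sq_sum_le_card_mul_sum_sq (s := Finset.univ) (f := fun i => √(hH.eigenvalues i))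
  refine h.trans_eq ?_
  rw [Finset.card_univ, hH.trace_eq_sum_eigenvalues, Complex.re_sum]
  congr 1
  refine Finset.sum_congr rfl fun i _ => ?_
  rw [Real.sq_sqrt (Matrix.eigenvalues_conjTranspose_mul_self_nonneg X i)]
  simp

theorem continuousOn_traceNorm :
    ContinuousOn (traceNorm (m := m)) {X | X.IsHermitian} := by
  have hg : Continuous fun X : Matrix m m ℂ =>
      √(Fintype.card m * (X.conjTranspose * X).trace.re) := by fun_prop
  have hbound (X Y : Matrix m m ℂ) (hX : X.IsHermitian) (hY : Y.IsHermitian) :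
      traceNorm Y ≤ traceNorm X +
        √(Fintype.card m * ((Y - X).conjTranspose * (Y - X)).trace.re) := by
    have h := traceNorm_add_le hX (hY.sub hX)
    rw [add_sub_cancel] at h
    exact h.trans (by gcongr; exact traceNorm_le_sqrt _)
  intro X hX
  have hlim : Filter.Tendsto (fun Y : Matrix m m ℂ =>
      √(Fintype.card m * ((Y - X).conjTranspose * (Y - X)).trace.re))
      (nhdsWithin X {X | X.IsHermitian}) (nhds 0) := by
    have : Continuous fun Y : Matrix m m ℂ =>
      √(Fintype.card m * ((Y - X).conjTranspose * (Y - X)).trace.re) :=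
      hg.comp (continuous_id.sub continuous_const)
    have h0 := this.tendsto X
    simp only [sub_self, Matrix.trace_zero, Complex.zero_re, mul_zero,
      Real.sqrt_zero] at h0
    exact h0.mono_left nhdsWithin_le_nhds
  refine tendsto_iff_dist_tendsto_zero.mpr (squeeze_zero' (.of_forall fun _ => dist_nonneg) ?_ hlim)
  filter_upwards [self_mem_nhdsWithin] with Y hY
  rw [Real.dist_eq]
  refine abs_sub_le_iff.mpr ⟨by linarith [hbound X Y hX hY], ?_⟩
  have h := hbound Y X hY hX
  rw [← neg_sub Y X, Matrix.conjTranspose_neg, neg_mul_neg] at h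
  linarith

end TraceNorm

/-! ### Compactness and convexity of the density matrices -/

section DensityMatrices

variable {m : Type*} [Fintype m]

open scoped MatrixOrder Matrix.Norms.L2Operator in
theorem exists_eq_conjTranspose_mul_self {A : Matrix m m ℂ} (hA : A.PosSemidef) :
    ∃ B : Matrix m m ℂ, A = B.conjTranspose * B := by
  classical
  exact CStarAlgebra.nonneg_iff_eq_star_mul_self.mp hA.nonneg

/-- The density matrices are the image of the Hilbert–Schmidt unit sphere under B ↦ Bᴴ B. -/
theorem isCompact_densityMatrices [DecidableEq m] : IsCompact (densityMatrices m) := by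
  let S : Set (Matrix m m ℂ) := {B | (B.conjTranspose * B).trace = 1}
  have hS : IsCompact S := by
    have hball : IsCompact (Set.univ.pi fun _ : m => Set.univ.pi fun _ : m =>
        Metric.closedBall (0 : ℂ) 1) :=
      isCompact_univ_pi fun _ => isCompact_univ_pi fun _ => isCompact_closedBall _ _
    refine hball.of_isClosed_subset (isClosed_eq (by fun_prop) continuous_const)
      fun (B : Matrix m m ℂ) hB => ?_
    intro i _ j _
    change B i j ∈ Metric.closedBall (0 : ℂ) 1
    have h : ∑ y, ∑ x, ‖B x y‖ ^ 2 = 1 := by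
      have := congrArg Complex.re (show (B.conjTranspose * B).trace = 1 from hB)
      simp only [Matrix.trace, Matrix.diag_apply, Matrix.mul_apply, Matrix.conjTranspose_apply,
        Complex.re_sum, Complex.one_re] at this
      rw [← this]
      refine Finset.sum_congr rfl fun y _ => Finset.sum_congr rfl fun x _ => ?_
      rw [Complex.star_def, ← Complex.normSq_eq_conj_mul_self, Complex.ofReal_re,
        Complex.normSq_eq_norm_sq]
    have h1 : ‖B i j‖ ^ 2 ≤ 1 := by
      rw [← h]
      refine le_trans ?_ (Finset.single_le_sum (f := fun y => ∑ x, ‖B x y‖ ^ 2)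
        (fun y _ => Finset.sum_nonneg fun x _ => by positivity) (Finset.mem_univ j))
      exact Finset.single_le_sum (f := fun x => ‖B x j‖ ^ 2) (fun x _ => by positivity)
        (Finset.mem_univ i)
    rw [mem_closedBall_zero_iff]
    exact (sq_le_one_iff₀ (norm_nonneg _)).mp h1
  have himage : densityMatrices m = (fun B : Matrix m m ℂ => B.conjTranspose * B) '' S := by
    ext ρ
    constructor
    · rintro ⟨h, ht⟩
      obtain ⟨B, rfl⟩ := exists_eq_conjTranspose_mul_self h
      exact ⟨B, ht, rfl⟩
    · rintro ⟨B, hB, rfl⟩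
      exact ⟨Matrix.posSemidef_conjTranspose_mul_self B, hB⟩
  rw [himage]
  exact hS.image (by fun_prop)

theorem convex_densityMatrices : Convex ℝ (densityMatrices m) := by
  rintro ρ ⟨hρ, hρt⟩ σ ⟨hσ, hσt⟩ s t hs ht hst
  refine ⟨(hρ.smul hs).add (hσ.smul ht), ?_⟩
  rw [Matrix.trace_add, Matrix.trace_smul, Matrix.trace_smul, hρt, hσt, ← add_smul, hst, one_smul]

theorem inv_card_smul_one_mem_densityMatrices [DecidableEq m] [Nonempty m] :
    ((Fintype.card m : ℝ)⁻¹ • (1 : Matrix m m ℂ)) ∈ densityMatrices m := by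
  refine ⟨Matrix.PosSemidef.one.smul (by positivity), ?_⟩
  rw [Matrix.trace_smul, Matrix.trace_one, Complex.real_smul]
  push_cast
  exact inv_mul_cancel₀ (by simp)

theorem traceNorm_of_mem_densityMatrices [DecidableEq m] {ρ : Matrix m m ℂ}
    (hρ : ρ ∈ densityMatrices m) : traceNorm ρ = 1 := by
  rw [traceNorm_of_posSemidef hρ.1, hρ.2, Complex.one_re]

end DensityMatrices

/-! ### Choi matrices and complete positivity -/

section Choi

variable {n : Type*}

/-- The Choi matrix of an operation. -/
def choi [DecidableEq n] (N : Operation n) : Matrix (n × n) (n × n) ℂ :=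
  Matrix.of fun p q => N (Matrix.single p.1 q.1 1) p.2 q.2

/-- The operation with a given Choi matrix. -/
def ofChoi [Fintype n] (P : Matrix (n × n) (n × n) ℂ) : Operation n where
  toFun X := Matrix.of fun a b => ∑ p, ∑ q, X p q * P (p, a) (q, b)
  map_add' X Y := by
    ext a b
    simp [add_mul, Finset.sum_add_distrib]
  map_smul' c X := by
    ext a b
    simp [mul_assoc, Finset.mul_sum]

/-- The partial trace over the second tensor factor. -/
def partialTrace [Fintype n] (P : Matrix (n × n) (n × n) ℂ) : Matrix n n ℂ :=
  Matrix.of fun p q => ∑ a, P (p, a) (q, a)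

theorem ofChoi_apply [Fintype n] (P : Matrix (n × n) (n × n) ℂ) (X : Matrix n n ℂ) (a b : n) :
    ofChoi P X a b = ∑ p, ∑ q, X p q * P (p, a) (q, b) := rfl

theorem ofChoi_sub [Fintype n] (P Q : Matrix (n × n) (n × n) ℂ) :
    ofChoi (P - Q) = ofChoi P - ofChoi Q := by
  ext1 X
  ext a b
  simp [ofChoi_apply, mul_sub, Finset.sum_sub_distrib]

theorem ofChoi_add [Fintype n] (P Q : Matrix (n × n) (n × n) ℂ) :
    ofChoi (P + Q) = ofChoi P + ofChoi Q := by
  ext1 X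
  ext a b
  simp [ofChoi_apply, mul_add, Finset.sum_add_distrib]

theorem ofChoi_smul [Fintype n] (r : ℝ) (P : Matrix (n × n) (n × n) ℂ) :
    ofChoi (r • P) = r • ofChoi P := by
  ext1 X
  ext a b
  simp only [ofChoi_apply, LinearMap.smul_apply, Matrix.smul_apply, Finset.smul_sum,
    mul_smul_comm]

theorem ofChoi_choi [Fintype n] [DecidableEq n] (N : Operation n) : ofChoi (choi N) = N := by
  ext1 X
  conv_rhs => rw [Matrix.matrix_eq_sum_single X]
  ext a b
  simp only [ofChoi_apply, choi, Matrix.of_apply, map_sum, Matrix.sum_apply]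
  refine Finset.sum_congr rfl fun p _ => Finset.sum_congr rfl fun q _ => ?_
  rw [← mul_one (X p q), ← smul_eq_mul (X p q) 1, ← Matrix.smul_single, map_smul,
    Matrix.smul_apply, smul_eq_mul, smul_eq_mul, mul_one]

theorem trace_ofChoi [Fintype n] (P : Matrix (n × n) (n × n) ℂ) (X : Matrix n n ℂ) :
    (ofChoi P X).trace = ∑ p, ∑ q, X p q * partialTrace P p q := by
  simp only [Matrix.trace, Matrix.diag_apply, ofChoi_apply, partialTrace, Matrix.of_apply,
    Finset.mul_sum]
  rw [Finset.sum_comm]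
  exact Finset.sum_congr rfl fun p _ => Finset.sum_comm

theorem trace_ofChoi_of_partialTrace_eq [Fintype n] [DecidableEq n]
    {P : Matrix (n × n) (n × n) ℂ} {c : ℂ} (hP : partialTrace P = c • 1) (X : Matrix n n ℂ) :
    (ofChoi P X).trace = c * X.trace := by
  rw [trace_ofChoi, hP]
  simp [Matrix.one_apply, Matrix.trace, Finset.mul_sum, mul_comm]

theorem partialTrace_choi [Fintype n] [DecidableEq n] {N : Operation n} {c : ℂ}
    (hN : ∀ X, (N X).trace = c * X.trace) : partialTrace (choi N) = c • 1 := by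
  ext p q
  have h := hN (Matrix.single p q 1)
  rw [Matrix.smul_apply, Matrix.one_apply, smul_eq_mul]
  change (N (Matrix.single p q 1)).trace = _
  rw [h]
  by_cases hpq : p = q
  · subst hpq; simp
  · simp [hpq]

/-- X + Xᴴ and i(X - Xᴴ) are Hermitian; their images determine N Xᴴ by complex linearity. -/
theorem map_conjTranspose_of_isHermitianPreserving {N : Operation n}
    (hN : IsHermitianPreserving N) (X : Matrix n n ℂ) :
    N X.conjTranspose = (N X).conjTranspose := by
  have h1 : (X + X.conjTranspose).IsHermitian := by
    rw [Matrix.IsHermitian, Matrix.conjTranspose_add, Matrix.conjTranspose_conjTranspose, add_comm]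
  have h2 : (Complex.I • (X - X.conjTranspose)).IsHermitian := by
    rw [Matrix.IsHermitian, Matrix.conjTranspose_smul, Matrix.conjTranspose_sub,
      Matrix.conjTranspose_conjTranspose, Complex.star_def, Complex.conj_I, neg_smul, ← smul_neg,
      neg_sub]
  have e1 := (hN _ h1).eq
  have e2 := (hN _ h2).eq
  rw [map_add, Matrix.conjTranspose_add] at e1
  rw [map_smul, map_sub, Matrix.conjTranspose_smul, Matrix.conjTranspose_sub, Complex.star_def,
    Complex.conj_I, neg_smul, ← smul_neg, neg_sub] at e2
  have e2' := smul_right_injective _ Complex.I_ne_zero e2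
  ext i j
  have f1 := congrFun (congrFun e1 i) j
  have f2 := congrFun (congrFun e2' i) j
  simp only [Matrix.add_apply, Matrix.sub_apply] at f1 f2
  linear_combination -(f1 - f2) / 2

theorem isHermitian_idTensor {k : Type*} {N : Operation n} (hN : IsHermitianPreserving N)
    {X : Matrix (k × n) (k × n) ℂ} (hX : X.IsHermitian) : (idTensor k N X).IsHermitian := by
  ext p q
  have h := map_conjTranspose_of_isHermitianPreserving hN
    (Matrix.of fun a b => X (q.1, a) (p.1, b))
  have e : (Matrix.of fun a b => X (q.1, a) (p.1, b) : Matrix n n ℂ).conjTranspose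
      = Matrix.of fun a b => X (p.1, a) (q.1, b) := by
    ext a b
    exact hX.apply _ _
  rw [e] at h
  change star (N (Matrix.of fun a b => X (q.1, a) (p.1, b)) q.2 p.2)
    = N (Matrix.of fun a b => X (p.1, a) (q.1, b)) p.2 q.2
  rw [h, Matrix.conjTranspose_apply]

theorem idTensor_ofChoi_apply [Fintype n] {k : Type*} (P : Matrix (n × n) (n × n) ℂ)
    (X : Matrix (k × n) (k × n) ℂ) (x y : k × n) :
    idTensor k (ofChoi P) X x y = ∑ p, ∑ q, X (x.1, p) (y.1, q) * P (p, x.2) (q, y.2) := rfl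

/-- Operations with positive semidefinite Choi matrix are completely positive. -/
theorem isCompletelyPositive_ofChoi [Fintype n] [DecidableEq n] {P : Matrix (n × n) (n × n) ℂ}
    (hP : P.PosSemidef) : IsCompletelyPositive (ofChoi P) := by
  intro k X hX
  -- Over triples (ancilla, input, output), the Schur product of the pullbacks of X and P is
  -- positive semidefinite; congruence by V sums out the input index and gives the image of X.
  let V : Matrix ((Fin k × n) × n) (Fin k × n) ℂ :=
    Matrix.of fun z x => if z.1.1 = x.1 ∧ z.2 = x.2 then 1 else 0
  have hM := (hX.submatrix (Prod.fst : (Fin k × n) × n → Fin k × n)).hadamard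
    (hP.submatrix fun z : (Fin k × n) × n => (z.1.2, z.2))
  have h := hM.conjTranspose_mul_mul_same V
  refine (congrArg Matrix.PosSemidef ?_).mpr h
  ext x y
  rw [idTensor_ofChoi_apply]
  simp only [Matrix.mul_apply, Matrix.conjTranspose_apply, V, Matrix.of_apply,
    Fintype.sum_prod_type, Matrix.hadamard_apply, Matrix.submatrix_apply]
  simp [ite_and, apply_ite (starRingEnd ℂ)]
  rw [Finset.sum_comm]

/-- Complete positivity, for ancillas with an arbitrary finite basis. -/
theorem IsCompletelyPositive.posSemidef_idTensor {k : Type*} [Fintype k] {E : Operation n}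
    (hE : IsCompletelyPositive E) {X : Matrix (k × n) (k × n) ℂ} (hX : X.PosSemidef) :
    (idTensor k E X).PosSemidef := by
  let e := Fintype.equivFin k
  have h := hE _ _ (hX.submatrix fun z : Fin (Fintype.card k) × n => (e.symm z.1, z.2))
  have h' := h.submatrix fun z : k × n => (e z.1, z.2)
  convert h' using 1
  ext p q
  simp [idTensor]

theorem trace_idTensor [Fintype n] {k : Type*} [Fintype k] {N : Operation n} {c : ℂ}
    (hN : ∀ X, (N X).trace = c * X.trace) (X : Matrix (k × n) (k × n) ℂ) :
    (idTensor k N X).trace = c * X.trace := by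
  simp only [Matrix.trace, Matrix.diag_apply, Fintype.sum_prod_type, Finset.mul_sum]
  refine Finset.sum_congr rfl fun i _ => ?_
  have h := hN (Matrix.of fun a b => X (i, a) (i, b))
  simp only [Matrix.trace, Matrix.diag_apply, Finset.mul_sum] at h
  exact h

/-- `id ⊗ N` maps the pure state with amplitude matrix `B` to a congruence transform of the Choi
matrix of `N`. -/
theorem idTensor_ofChoi_vecMulVec [Fintype n] [DecidableEq n] (P : Matrix (n × n) (n × n) ℂ)
    (B : Matrix n n ℂ) :
    idTensor n (ofChoi P) (Matrix.vecMulVec (fun p => B p.1 p.2) (star fun p => B p.1 p.2)) =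
      (B ⊗ₖ (1 : Matrix n n ℂ)) * P * (B ⊗ₖ (1 : Matrix n n ℂ)).conjTranspose := by
  ext x y
  rw [idTensor_ofChoi_apply]
  simp only [Matrix.mul_apply, Matrix.conjTranspose_apply, Fintype.sum_prod_type,
    Matrix.kroneckerMap_apply, Matrix.vecMulVec_apply, Pi.star_apply, Matrix.one_apply]
  simp [Finset.sum_mul, apply_ite (starRingEnd ℂ)]
  rw [Finset.sum_comm]
  refine Finset.sum_congr rfl fun p _ => Finset.sum_congr rfl fun q _ => ?_
  ring

/-- Bᵀ B̄ is the marginal, on the factor where the map acts, of the pure state with amplitude matrix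
B; the trace of the image sees only this marginal. -/
theorem trace_kronecker_one_conj [Fintype n] [DecidableEq n] (P : Matrix (n × n) (n × n) ℂ)
    (B : Matrix n n ℂ) :
    ((B ⊗ₖ (1 : Matrix n n ℂ)) * P * (B ⊗ₖ (1 : Matrix n n ℂ)).conjTranspose).trace =
      (ofChoi P (B.transpose * B.map star)).trace := by
  rw [← idTensor_ofChoi_vecMulVec]
  simp only [Matrix.trace, Matrix.diag_apply, Fintype.sum_prod_type, idTensor_ofChoi_apply,
    ofChoi_apply, Matrix.mul_apply, Matrix.vecMulVec_apply, Pi.star_apply, Matrix.transpose_apply,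
    Matrix.map_apply, Finset.sum_mul]
  rw [Finset.sum_comm]
  refine Finset.sum_congr rfl fun a _ => ?_
  rw [Finset.sum_comm]
  refine Finset.sum_congr rfl fun p _ => ?_
  rw [Finset.sum_comm]

end Choi

/-! ### Lower bound on costs, and the minimax argument for majorants -/

section Duality

variable {n : Type*}

theorem trace_re_nonneg {m : Type*} [Fintype m] {P : Matrix m m ℂ} (hP : P.PosSemidef) :
    0 ≤ P.trace.re :=
  (Complex.le_def.mp hP.trace_nonneg).1

theorem idTensor_sum_smul {k : ℕ} (x : Fin k → ℝ) (E : Fin k → Operation n)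
    (X : Matrix (n × n) (n × n) ℂ) :
    idTensor n (∑ i, x i • E i) X = ∑ i, x i • idTensor n (E i) X := by
  ext p q
  simp [idTensor, Matrix.sum_apply]

/-- The positive semidefinite matrices that dominate `J`. -/
def majorants (J : Matrix (n × n) (n × n) ℂ) : Set (Matrix (n × n) (n × n) ℂ) :=
  {P | P.PosSemidef ∧ (P - J).PosSemidef}

theorem convex_majorants (J : Matrix (n × n) (n × n) ℂ) : Convex ℝ (majorants J) := by
  rintro P ⟨hP, hPJ⟩ Q ⟨hQ, hQJ⟩ s t hs ht hst
  refine ⟨(hP.smul hs).add (hQ.smul ht), ?_⟩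
  have e : s • P + t • Q - J = s • (P - J) + t • (Q - J) := by
    conv_lhs => rw [← one_smul ℝ J, ← hst]
    module
  rw [e]
  exact (hPJ.smul hs).add (hQJ.smul ht)

variable [Fintype n]

theorem trace_ofChoi_re_nonneg [DecidableEq n] {P : Matrix (n × n) (n × n) ℂ}
    (hP : P.PosSemidef) {σ : Matrix n n ℂ} (hσ : σ.PosSemidef) :
    0 ≤ (ofChoi P σ).trace.re := by
  obtain ⟨B, rfl⟩ := exists_eq_conjTranspose_mul_self hσ
  have h := trace_re_nonneg (hP.mul_mul_conjTranspose_same (B.map star ⊗ₖ (1 : Matrix n n ℂ)))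
  rw [trace_kronecker_one_conj] at h
  rw [show (B.map star).map star = B by ext i j; simp] at h
  exact h

/-- The diamond norm is attained. -/
theorem exists_isGreatest_diamondRatios [DecidableEq n] [Nonempty n] {N : Operation n}
    (hHP : IsHermitianPreserving N) : IsGreatest (diamondRatios N) (diamondNorm N) := by
  have hcont : ContinuousOn (fun ρ => traceNorm (idTensor n N ρ)) (densityMatrices (n × n)) :=
    continuousOn_traceNorm.comp
      (LinearMap.continuous_of_finiteDimensional (idTensor n N)).continuousOn
      fun ρ hρ => isHermitian_idTensor hHP hρ.1.1
  obtain ⟨ρ, hρ, hmax⟩ := isCompact_densityMatrices.exists_isMaxOn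
    ⟨_, inv_card_smul_one_mem_densityMatrices⟩ hcont
  have h : IsGreatest (diamondRatios N) (traceNorm (idTensor n N ρ) / traceNorm ρ) := by
    refine ⟨⟨ρ, hρ, rfl⟩, ?_⟩
    rintro _ ⟨σ, hσ, rfl⟩
    rw [traceNorm_of_mem_densityMatrices hρ, traceNorm_of_mem_densityMatrices hσ, div_one, div_one]
    exact hmax hσ
  rw [diamondNorm, h.csSup_eq]
  exact h

theorem traceNorm_idTensor_le_diamondNorm [DecidableEq n] [Nonempty n] {N : Operation n}
    (hHP : IsHermitianPreserving N) {ρ : Matrix (n × n) (n × n) ℂ}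
    (hρ : ρ ∈ densityMatrices (n × n)) : traceNorm (idTensor n N ρ) ≤ diamondNorm N :=
  (exists_isGreatest_diamondRatios hHP).2
    ⟨ρ, hρ, by rw [traceNorm_of_mem_densityMatrices hρ, div_one]⟩

/-- The image of any density matrix has trace c. This bound later makes both coefficients α and α -
c positive. -/
theorem abs_le_diamondNorm [DecidableEq n] [Nonempty n] {N : Operation n}
    (hHP : IsHermitianPreserving N) {c : ℝ} (hN : ∀ X, (N X).trace = (c : ℂ) * X.trace) :
    |c| ≤ diamondNorm N := by
  have hρ := inv_card_smul_one_mem_densityMatrices (m := n × n)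
  refine le_trans ?_ (traceNorm_idTensor_le_diamondNorm hHP hρ)
  have h := abs_trace_re_le_traceNorm (isHermitian_idTensor hHP hρ.1.1)
  rwa [trace_idTensor hN, hρ.2, mul_one, Complex.ofReal_re] at h

/-- Every quasiprobability decomposition into channels costs at least the diamond norm. -/
theorem diamondNorm_le_of_mem_decompositionCosts [DecidableEq n] [Nonempty n] {N : Operation n}
    (hHP : IsHermitianPreserving N) {s : ℝ} (hs : s ∈ decompositionCosts (channels n) N) :
    diamondNorm N ≤ s := by
  obtain ⟨ρ, hρ, h⟩ := (exists_isGreatest_diamondRatios hHP).1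
  obtain ⟨k, x, E, hE, hN, rfl⟩ := hs
  rw [h, traceNorm_of_mem_densityMatrices hρ, div_one, hN, idTensor_sum_smul]
  have hpos (i) : (idTensor n (E i) ρ).PosSemidef := (hE i).1.posSemidef_idTensor hρ.1
  have htr (i) : (idTensor n (E i) ρ).trace = 1 := by
    rw [trace_idTensor (c := 1) (fun X => by rw [(hE i).2 X, one_mul]), hρ.2, one_mul]
  -- Grouping by the sign of x i leaves two positive semidefinite matrices whose traces add up to
  -- the cost.
  have e : ∑ i, x i • idTensor n (E i) ρ =
      ∑ i, (x i)⁺ • idTensor n (E i) ρ - ∑ i, (x i)⁻ • idTensor n (E i) ρ := by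
    rw [← Finset.sum_sub_distrib]
    refine Finset.sum_congr rfl fun i _ => ?_
    rw [← sub_smul, posPart_sub_negPart]
  rw [e]
  refine (traceNorm_sub_le
    (Matrix.posSemidef_sum _ fun i _ => (hpos i).smul (posPart_nonneg _))
    (Matrix.posSemidef_sum _ fun i _ => (hpos i).smul (negPart_nonneg _))).trans_eq ?_
  simp only [Matrix.trace_sum, Matrix.trace_smul, htr, Complex.re_sum, Complex.smul_re,
    Complex.one_re, smul_eq_mul, mul_one]
  rw [← Finset.sum_add_distrib]
  exact Finset.sum_congr rfl fun i _ => posPart_add_negPart _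

/-- For an invertible density matrix `σ`, half of `‖N‖_⋄ + c` bounds the least value at `σ` of the
positive majorants of the Choi matrix. -/
theorem exists_mem_majorants_trace_le_of_posDef [DecidableEq n] [Nonempty n] {N : Operation n}
    (hHP : IsHermitianPreserving N) {c : ℝ} (hN : ∀ X, (N X).trace = (c : ℂ) * X.trace)
    {σ : Matrix n n ℂ} (hσ : σ.PosDef) (hσt : σ.trace = 1) :
    ∃ P ∈ majorants (choi N), (ofChoi P σ).trace.re ≤ (diamondNorm N + c) / 2 := by
  obtain ⟨C, hC⟩ := exists_eq_conjTranspose_mul_self hσ.posSemidef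
  -- The conjugate makes Bᵀ B̄ = Cᴴ C = σ, so the pure state ρ below purifies σ.
  set B := C.map star with hB
  have hBσ : B.transpose * B.map star = σ := by
    rw [hC]
    congr 1
    ext i j
    simp [hB]
  have hBu : IsUnit B.det := by
    have h := (Matrix.isUnit_iff_isUnit_det _).mp hσ.isUnit
    rw [← hBσ, Matrix.det_mul, Matrix.det_transpose] at h
    exact isUnit_of_mul_isUnit_left h
  set G := B ⊗ₖ (1 : Matrix n n ℂ) with hG
  set H := B⁻¹ ⊗ₖ (1 : Matrix n n ℂ) with hH
  have hGH : G * H = 1 := by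
    rw [hG, hH, ← Matrix.mul_kronecker_mul, Matrix.mul_nonsing_inv _ hBu, one_mul,
      Matrix.one_kronecker_one]
  have hHG : H * G = 1 := by
    rw [hG, hH, ← Matrix.mul_kronecker_mul, Matrix.nonsing_inv_mul _ hBu, one_mul,
      Matrix.one_kronecker_one]
  have hGHs : H.conjTranspose * G.conjTranspose = 1 := by
    rw [← Matrix.conjTranspose_mul, hGH, Matrix.conjTranspose_one]
  have hHGs : G.conjTranspose * H.conjTranspose = 1 := by
    rw [← Matrix.conjTranspose_mul, hHG, Matrix.conjTranspose_one]
  set ρ : Matrix (n × n) (n × n) ℂ :=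
    Matrix.vecMulVec (fun p => B p.1 p.2) (star fun p => B p.1 p.2) with hρ_def
  have hρ : ρ ∈ densityMatrices (n × n) := by
    refine ⟨Matrix.posSemidef_vecMulVec_self_star _, ?_⟩
    rw [← hσt, ← hBσ]
    simp only [ρ, Matrix.trace, Matrix.diag_apply, Fintype.sum_prod_type, Matrix.vecMulVec_apply,
      Matrix.mul_apply, Pi.star_apply, Matrix.transpose_apply, Matrix.map_apply]
    exact Finset.sum_comm
  have hX : idTensor n N ρ = G * choi N * G.conjTranspose := by
    rw [← idTensor_ofChoi_vecMulVec, ofChoi_choi]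
  -- Tr R + Tr S ≤ D and Tr R - Tr S = c give Tr R ≤ (D + c)/2; the majorant is R pulled back
  -- through G⁻¹ = H.
  obtain ⟨R, S, hR, hS, hRS, ht⟩ :=
    exists_posSemidef_sub_traceNorm (isHermitian_idTensor hHP hρ.1.1)
  have hD := traceNorm_idTensor_le_diamondNorm hHP hρ
  have htr : R.trace.re - S.trace.re = c := by
    rw [← Complex.sub_re, ← Matrix.trace_sub, ← hRS, trace_idTensor hN, hρ.2, mul_one,
      Complex.ofReal_re]
  have hconj (Y : Matrix (n × n) (n × n) ℂ) :
      H * (G * Y * G.conjTranspose) * H.conjTranspose = Y := by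
    calc _ = (H * G) * Y * (G.conjTranspose * H.conjTranspose) := by simp only [mul_assoc]
      _ = Y := by rw [hHG, hHGs, one_mul, mul_one]
  refine ⟨H * R * H.conjTranspose, ⟨hR.mul_mul_conjTranspose_same H, ?_⟩, ?_⟩
  · have e : H * R * H.conjTranspose - choi N = H * S * H.conjTranspose := by
      conv_lhs => rw [← hconj (choi N), ← hX, hRS]
      rw [← sub_mul, ← mul_sub, sub_sub_cancel]
    rw [e]
    exact hS.mul_mul_conjTranspose_same H
  · have e : G * (H * R * H.conjTranspose) * G.conjTranspose = R := by
      calc _ = (G * H) * R * (H.conjTranspose * G.conjTranspose) := by simp only [mul_assoc]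
        _ = R := by rw [hGH, hGHs, one_mul, mul_one]
    rw [← hBσ, ← trace_kronecker_one_conj, ← hG, e]
    linarith

/-- Mixing σ with a little of the maximally mixed state makes it invertible; the slack ε pays for
the mixing. -/
theorem exists_mem_majorants_trace_lt [DecidableEq n] [Nonempty n] {N : Operation n}
    (hHP : IsHermitianPreserving N) {c : ℝ} (hN : ∀ X, (N X).trace = (c : ℂ) * X.trace)
    {σ : Matrix n n ℂ} (hσ : σ ∈ densityMatrices n) {ε : ℝ} (hε : 0 < ε) :
    ∃ P ∈ majorants (choi N), (ofChoi P σ).trace.re < (diamondNorm N + c) / 2 + ε := by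
  set a := (diamondNorm N + c) / 2 with ha
  have ha0 : 0 ≤ a := by
    have := neg_le_of_abs_le (abs_le_diamondNorm hHP hN)
    rw [ha]; linarith
  -- Chosen so that δ(a + ε) = ε/2, hence a < (1 - δ)(a + ε).
  set δ := ε / (2 * (a + ε)) with hδ
  have hδ0 : 0 < δ := by positivity
  have hδ1 : δ < 1 := by rw [hδ, div_lt_one (by positivity)]; linarith
  have hμ := inv_card_smul_one_mem_densityMatrices (m := n)
  set μ : Matrix n n ℂ := (Fintype.card n : ℝ)⁻¹ • 1 with hμ_def
  have hμpd : μ.PosDef := Matrix.PosDef.one.smul (by positivity)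
  have hτ := convex_densityMatrices hσ hμ (sub_nonneg.mpr hδ1.le) hδ0.le (sub_add_cancel 1 δ)
  have hτpd : ((1 - δ) • σ + δ • μ).PosDef :=
    Matrix.PosDef.posSemidef_add (hσ.1.smul (sub_nonneg.mpr hδ1.le)) (hμpd.smul hδ0)
  obtain ⟨P, hP, hle⟩ := exists_mem_majorants_trace_le_of_posDef hHP hN hτpd hτ.2
  refine ⟨P, hP, ?_⟩
  have h1 := trace_ofChoi_re_nonneg hP.1 hμ.1
  have e : (ofChoi P ((1 - δ) • σ + δ • μ)).trace.re =
      (1 - δ) * (ofChoi P σ).trace.re + δ * (ofChoi P μ).trace.re := by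
    rw [map_add, Matrix.trace_add, Complex.add_re, LinearMap.map_smul_of_tower,
      LinearMap.map_smul_of_tower, Matrix.trace_smul, Matrix.trace_smul, Complex.smul_re,
      Complex.smul_re, smul_eq_mul, smul_eq_mul]
  rw [e] at hle
  have h2 : (1 - δ) * (ofChoi P σ).trace.re ≤ a := by nlinarith
  have h3 : a < (1 - δ) * (a + ε) := by
    have : δ * (a + ε) = ε / 2 := by rw [hδ]; field_simp
    linarith
  exact lt_of_mul_lt_mul_left (h2.trans_lt h3) (sub_nonneg.mpr hδ1.le)

/-- The real-bilinear pairing `(σ, P) ↦ -Re Tr (ofChoi P σ)`. -/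
noncomputable def choiPairing (n : Type*) [Fintype n] :
    Matrix n n ℂ →ₗ[ℝ] Matrix (n × n) (n × n) ℂ →ₗ[ℝ] ℝ :=
  LinearMap.mk₂ ℝ (fun σ P => -(ofChoi P σ).trace.re)
    (fun σ τ P => by rw [map_add, Matrix.trace_add, Complex.add_re, neg_add])
    (fun r σ P => by
      rw [LinearMap.map_smul_of_tower, Matrix.trace_smul, Complex.smul_re, smul_neg])
    (fun σ P Q => by
      rw [ofChoi_add, LinearMap.add_apply, Matrix.trace_add, Complex.add_re, neg_add])
    (fun r σ P => by
      rw [ofChoi_smul, LinearMap.smul_apply, Matrix.trace_smul, Complex.smul_re, smul_neg])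

theorem exists_mem_majorants_forall_trace_lt [DecidableEq n] [Nonempty n] {N : Operation n}
    (hHP : IsHermitianPreserving N) {c : ℝ} (hN : ∀ X, (N X).trace = (c : ℂ) * X.trace)
    {ε : ℝ} (hε : 0 < ε) :
    ∃ P ∈ majorants (choi N), ∀ σ ∈ densityMatrices n,
      (ofChoi P σ).trace.re < (diamondNorm N + c) / 2 + ε := by
  set a := (diamondNorm N + c) / 2 with ha
  have hc1 (P) : Continuous fun σ : Matrix n n ℂ => choiPairing n σ P :=
    LinearMap.continuous_of_finiteDimensional ((choiPairing n).flip P)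
  have hc2 (σ) : Continuous fun P => choiPairing n σ P :=
    LinearMap.continuous_of_finiteDimensional (choiPairing n σ)
  have hK := isCompact_densityMatrices (m := n)
  -- The majorants are not compact, but compactness of the density matrices reduces to finitely many
  -- P, as the finite form of Sion's theorem needs. The sign in `choiPairing` puts the compact
  -- variable on the minimised side.
  obtain ⟨s, hsY, hs⟩ : ∃ s : Finset (Matrix (n × n) (n × n) ℂ),
      (∀ P ∈ s, P ∈ majorants (choi N)) ∧
      ∀ σ ∈ densityMatrices n, ∃ P ∈ s, -(a + ε) < choiPairing n σ P := by
    choose! P hP hlt using fun σ (hσ : σ ∈ densityMatrices n) =>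
      exists_mem_majorants_trace_lt hHP hN hσ hε
    classical
    obtain ⟨t, htD, ht⟩ := hK.elim_nhds_subcover
      (fun σ => {τ | -(a + ε) < choiPairing n τ (P σ)}) fun σ hσ =>
        (isOpen_lt continuous_const (hc1 (P σ))).mem_nhds (neg_lt_neg (hlt σ hσ))
    refine ⟨t.image P, fun Q hQ => ?_, fun σ hσ => ?_⟩
    · obtain ⟨σ, hσ, rfl⟩ := Finset.mem_image.mp hQ
      exact hP σ (htD σ hσ)
    · obtain ⟨τ, hτ, h⟩ := Set.mem_iUnion₂.mp (ht hσ)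
      exact ⟨P τ, Finset.mem_image_of_mem P hτ, h⟩
  obtain ⟨P, hP, h⟩ := Sion.exists_lt_iInf_of_lt_iInf_of_finite
    (X := densityMatrices n) (Y := majorants (choi N)) (f := fun σ P => choiPairing n σ P)
    ⟨_, inv_card_smul_one_mem_densityMatrices⟩ hK
    (fun P _ => (hc1 P).lowerSemicontinuous.lowerSemicontinuousOn _)
    (fun P _ => (((choiPairing n).flip P).convexOn convex_densityMatrices).quasiconvexOn)
    (convex_majorants _)
    (fun σ _ => (hc2 σ).upperSemicontinuous.upperSemicontinuousOn _)
    (fun σ _ => ((choiPairing n σ).concaveOn (convex_majorants _)).quasiconcaveOn)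
    convex_densityMatrices s.finite_toSet hsY hs
  exact ⟨P, hP, fun σ hσ => neg_lt_neg_iff.mp (h σ hσ)⟩

/-! ### From a majorant to two channels -/

theorem isHermitian_partialTrace {P : Matrix (n × n) (n × n) ℂ} (hP : P.IsHermitian) :
    (partialTrace P).IsHermitian := by
  ext p q
  simp only [partialTrace, Matrix.conjTranspose_apply, Matrix.of_apply, star_sum]
  exact Finset.sum_congr rfl fun a _ => hP.apply _ _

theorem posSemidef_smul_one_sub_partialTrace [DecidableEq n] {P : Matrix (n × n) (n × n) ℂ}
    (hP : P.IsHermitian) {α : ℝ}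
    (h : ∀ σ ∈ densityMatrices n, (ofChoi P σ).trace.re ≤ α) :
    (α • (1 : Matrix n n ℂ) - partialTrace P).PosSemidef := by
  have hH : (α • (1 : Matrix n n ℂ) - partialTrace P).IsHermitian := by
    refine Matrix.IsHermitian.sub ?_ (isHermitian_partialTrace hP)
    rw [Matrix.IsHermitian, Matrix.conjTranspose_smul, Matrix.conjTranspose_one, star_trivial]
  refine Matrix.PosSemidef.of_dotProduct_mulVec_nonneg hH fun y => ?_
  have him : (star y ⬝ᵥ ((α • (1 : Matrix n n ℂ) - partialTrace P).mulVec y)).im = 0 :=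
    hH.im_star_dotProduct_mulVec_self y
  suffices hre : 0 ≤ (star y ⬝ᵥ ((α • (1 : Matrix n n ℂ) - partialTrace P).mulVec y)).re from
    Complex.le_def.mpr ⟨hre, him.symm⟩
  -- Conjugated because `trace_ofChoi` pairs σ with the partial trace entrywise, without a
  -- transpose.
  set σ : Matrix n n ℂ := Matrix.vecMulVec (star y) (star (star y)) with hσ
  have hσp : σ.PosSemidef := Matrix.posSemidef_vecMulVec_self_star _
  have htP : (ofChoi P σ).trace = star y ⬝ᵥ ((partialTrace P).mulVec y) := by
    rw [trace_ofChoi]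
    simp only [dotProduct, Matrix.mulVec, Finset.mul_sum]
    refine Finset.sum_congr rfl fun p _ => Finset.sum_congr rfl fun q _ => ?_
    simp only [σ, Matrix.vecMulVec_apply, star_star]
    ring
  have htσ : σ.trace = star y ⬝ᵥ y := by
    rw [hσ, star_star, Matrix.trace_vecMulVec]
  have hle : (ofChoi P σ).trace.re ≤ α * σ.trace.re := by
    by_cases h0 : σ = 0
    · simp [h0]
    · have ht0 := trace_re_nonneg hσp
      have him' : σ.trace.im = 0 := (Complex.le_def.mp hσp.trace_nonneg).2.symm
      have ht : 0 < σ.trace.re := by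
        refine lt_of_le_of_ne ht0 fun h' => h0 (hσp.trace_eq_zero_iff.mp ?_)
        exact Complex.ext h'.symm him'
      have := h (σ.trace.re⁻¹ • σ) ⟨hσp.smul (inv_nonneg.mpr ht0), by
        rw [Matrix.trace_smul]
        refine Complex.ext ?_ ?_
        · simpa using inv_mul_cancel₀ ht.ne'
        · simp [him']⟩
      rw [LinearMap.map_smul_of_tower, Matrix.trace_smul, Complex.smul_re, smul_eq_mul,
        inv_mul_le_iff₀ ht] at this
      linarith
  rw [Matrix.sub_mulVec, dotProduct_sub, Complex.sub_re, Matrix.smul_mulVec, Matrix.one_mulVec,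
    dotProduct_smul, ← htP, ← htσ, Complex.smul_re, smul_eq_mul]
  linarith

theorem partialTrace_kronecker_one [DecidableEq n] (T : Matrix n n ℂ) :
    partialTrace (T ⊗ₖ (1 : Matrix n n ℂ)) = (Fintype.card n : ℝ) • T := by
  ext p q
  simp [partialTrace]

theorem ofChoi_mem_channels [DecidableEq n] {P : Matrix (n × n) (n × n) ℂ} (hP : P.PosSemidef)
    {α : ℝ} (hα : 0 < α) (ht : partialTrace P = (α : ℂ) • 1) :
    ofChoi (α⁻¹ • P) ∈ channels n := by
  refine ⟨isCompletelyPositive_ofChoi (hP.smul (inv_nonneg.mpr hα.le)), fun X => ?_⟩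
  rw [ofChoi_smul, LinearMap.smul_apply, Matrix.trace_smul, trace_ofChoi_of_partialTrace_eq ht,
    Complex.real_smul, ← mul_assoc, ← Complex.ofReal_mul, inv_mul_cancel₀ hα.ne',
    Complex.ofReal_one, one_mul]

theorem diamondNorm_add_mem_decompositionCosts [DecidableEq n] [Nonempty n] {N : Operation n}
    (hHP : IsHermitianPreserving N) (hTS : IsTraceScaling N) {ε : ℝ} (hε : 0 < ε) :
    diamondNorm N + 2 * ε ∈ decompositionCosts (channels n) N := by
  obtain ⟨c, hN⟩ := hTS
  obtain ⟨P, hP, hlt⟩ := exists_mem_majorants_forall_trace_lt hHP hN hε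
  set α := (diamondNorm N + c) / 2 + ε with hα
  have hc := abs_le.mp (abs_le_diamondNorm hHP hN)
  have hα0 : 0 < α := by rw [hα]; linarith
  have hαc : 0 < α - c := by rw [hα]; linarith
  have hT := posSemidef_smul_one_sub_partialTrace hP.1.1 fun σ hσ => (hlt σ hσ).le
  -- W supplies the missing partial trace α·1 - `partialTrace P`, spread evenly over the output;
  -- adding it keeps both P and P - J positive.
  set W : Matrix (n × n) (n × n) ℂ :=
    ((Fintype.card n : ℝ)⁻¹ • (α • (1 : Matrix n n ℂ) - partialTrace P)) ⊗ₖ (1 : Matrix n n ℂ)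
    with hW
  have hWp : W.PosSemidef := (hT.smul (by positivity)).kronecker Matrix.PosSemidef.one
  have hadd (A B : Matrix (n × n) (n × n) ℂ) :
      partialTrace (A + B) = partialTrace A + partialTrace B := by
    ext p q
    simp [partialTrace, Finset.sum_add_distrib]
  have hWt : partialTrace (P + W) = (α : ℂ) • 1 := by
    rw [hadd, hW, partialTrace_kronecker_one, smul_inv_smul₀ (by simp)]
    rw [add_sub_cancel]
    ext i j
    simp
  have hdt : partialTrace (P + W - choi N) = ((α - c : ℝ) : ℂ) • 1 := by
    have h := hadd (P + W - choi N) (choi N)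
    rw [sub_add_cancel, hWt, partialTrace_choi hN] at h
    rw [Complex.ofReal_sub, sub_smul, h, add_sub_cancel_right]
  have hd : (P + W - choi N).PosSemidef := by
    rw [add_sub_right_comm]
    exact hP.2.add hWp
  refine ⟨2, ![α, -(α - c)],
    ![ofChoi (α⁻¹ • (P + W)), ofChoi ((α - c)⁻¹ • (P + W - choi N))], ?_, ?_, ?_⟩
  · rw [Fin.forall_fin_two]
    exact ⟨ofChoi_mem_channels (hP.1.add hWp) hα0 hWt, ofChoi_mem_channels hd hαc hdt⟩
  · rw [Fin.sum_univ_two]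
    simp only [Matrix.cons_val_zero, Matrix.cons_val_one]
    rw [ofChoi_smul, ofChoi_smul, neg_smul, smul_inv_smul₀ hα0.ne', smul_inv_smul₀ hαc.ne',
      ofChoi_sub, ofChoi_choi]
    abel
  · rw [Fin.sum_univ_two]
    simp only [Matrix.cons_val_zero, Matrix.cons_val_one]
    rw [abs_neg, abs_of_pos hα0, abs_of_pos hαc, hα]
    ring

end Duality

end QuantumImpl

theorem mainTheorem9 {n : Type*} [Fintype n] [DecidableEq n] [Nonempty n]
    (N : QuantumImpl.Operation n)
    (hHP : QuantumImpl.IsHermitianPreserving N)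
    (hTS : QuantumImpl.IsTraceScaling N) :
    IsGreatest (QuantumImpl.diamondRatios N) (QuantumImpl.diamondNorm N) ∧
      (QuantumImpl.decompositionCosts (QuantumImpl.channels n) N).Nonempty ∧
      QuantumImpl.diamondNorm N =
        QuantumImpl.implementability (QuantumImpl.channels n) N := by
  have hne : (QuantumImpl.decompositionCosts (QuantumImpl.channels n) N).Nonempty :=
    ⟨_, QuantumImpl.diamondNorm_add_mem_decompositionCosts hHP hTS one_pos⟩
  have hlb : ∀ s ∈ QuantumImpl.decompositionCosts (QuantumImpl.channels n) N,
      QuantumImpl.diamondNorm N ≤ s :=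
    fun s hs => QuantumImpl.diamondNorm_le_of_mem_decompositionCosts hHP hs
  refine ⟨QuantumImpl.exists_isGreatest_diamondRatios hHP, hne,
    le_antisymm (le_csInf hne hlb) (le_of_forall_pos_le_add fun ε hε => ?_)⟩
  -- The constructed cost exceeds D by twice its parameter, hence ε/2.
  have h := csInf_le ⟨_, hlb⟩
    (QuantumImpl.diamondNorm_add_mem_decompositionCosts hHP hTS (half_pos hε))
  rwa [mul_div_cancel₀ ε two_ne_zero] at h
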